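/- Fix $n\in\mathbb{N}$ and write $[n]=\{1,\dots,n\}$. Cars $1,\dots,n$ arrive in this order on an initially empty one-way street with spots $1,\dots,n$ (driven in increasing order), car $i$ having a preferred spot $a_i\in[n]$. Under the MVP parking rule, car $i$ on arrival parks in spot $a_i$; if that spot was occupied by an earlier car $j$, then car $j$ is bumped, drives on, and parks in the first unoccupied spot after $a_i$, if there is one (a bumped car never bumps another car), and otherwise leaves the street unparked. The vector $\alpha=(a_1,\dots,a_n)\in[n]^n$ is an MVP parking function if all cars are parked at the end; let $\mathrm{MVP}_n$ be the set of these. For $\alpha\in\mathrm{MVP}_n$ let $\mathcal{O}_{\mathrm{MVP}_n}(\alpha)=\pi=(\pi_1,\dots,\pi_n)\in\mathfrak{S}_n$, where $\pi_k$ is the car parked in spot $k$ at the end, and for $\pi \in \mathfrak{S}_n$ let $\mathcal{O}_{\mathrm{MVP}_n}^{-1}(\pi)=\{\alpha\in\mathrm{MVP}_n:\mathcal{O}_{\mathrm{MVP}_n}(\alpha)=\pi\}$. For $\pi\in\mathfrak{S}_n$ and $j\in[n]$ let $$\mathcal{C}_j(\pi)=\bigl(\{\pi_1,\dots,\pi_{j-1}\}\cap\{\pi_j+1,\dots,n\}\bigr)\cup\{\pi_j\},\qquad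 \Omega_j(\pi)=\{k\in[j]:\pi_k\in\mathcal{C}_j(\pi)\}.$$ The permutation $\pi$ contains a pattern $\rho=(\rho_1,\dots,\rho_m)$ if there are indices $k_1<\dots<k_m$ such that, for all $i<j$, $\pi_{k_i}\le\pi_{k_j}$ if and only if $\rho_i\le\rho_j$; otherwise $\pi$ avoids $\rho$. **Theorem.** Let $n\in\mathbb{N}$ and $\pi\in\mathfrak{S}_n$. 1. $|\mathcal{O}_{\mathrm{MVP}_n}^{-1}(\pi)|=\prod_{j=1}^n|\Omega_j(\pi)|$ if and only if $\pi$ avoids both $(3,2,1)$ and $(3,4,1,2)$. 2. If $\pi$ contains $(3,2,1)$ or $(3,4,1,2)$, then $|\mathcal{O}_{\mathrm{MVP}_n}^{-1}(\pi)|<\prod_{j=1}^n|\Omega_j(\pi)|$. 3. If $\pi$ avoids both $(3,2,1)$ and $(3,4,1,2)$, then every $\alpha=(a_1,\dots,a_n)\in[n]^n$ with $a_{\pi_j}\in\Omega_j(\pi)$ for all $j\in[n]$ is an MVP parking function with $\mathcal{O}_{\mathrm{MVP}_n}(\alpha)=\pi$. -/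

import Mathlib

/-- The state of the street: `c k = some i` means that spot `k` is occupied by car `i`, and
`c k = none` that spot `k` is unoccupied. Spots and cars are both numbered by `Fin n`. -/
abbrev Street (n : ℕ) : Type := Fin n → Option (Fin n)

/-- The unoccupied spots strictly further down the one-way street than spot `a`. -/
def freeSpotsAfter {n : ℕ} (c : Street n) (a : Fin n) : Finset (Fin n) :=
  (Finset.Ioi a).filter (fun k => c k = none)

/-- The MVP parking rule. Car `i` arrives, with preferred spot `a`, and parks in spot `a`.
If spot `a` was occupied by a car `j`, then car `j` is bumped and parks in the first unoccupied
spot after `a`; if there is no such spot, car `j` leaves the street without parking. -/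
def mvpStep {n : ℕ} (c : Street n) (i a : Fin n) : Street n :=
  match c a with
  | none => Function.update c a (some i)
  | some j =>
    if h : (freeSpotsAfter c a).Nonempty then
      Function.update (Function.update c a (some i)) ((freeSpotsAfter c a).min' h) (some j)
    else
      Function.update c a (some i)

/-- The street after all the cars have arrived in order, car `i` preferring spot `α i`; the street
is empty at the start. -/
def mvpFinal {n : ℕ} (α : Fin n → Fin n) : Street n :=
  (List.finRange n).foldl (fun c i => mvpStep c i (α i)) (fun _ => none)

/-- `α` is an MVP parking function: all the cars are parked at the end. -/
def IsMVP {n : ℕ} (α : Fin n → Fin n) : Prop :=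
  ∀ i : Fin n, ∃ k : Fin n, mvpFinal α k = some i

/-- The set of MVP parking functions of length `n`. -/
def MVP (n : ℕ) : Set (Fin n → Fin n) := {α | IsMVP α}

/-- The spot in which car `i` ultimately parks. -/
noncomputable def mvpSpot {n : ℕ} (α : MVP n) (i : Fin n) : Fin n :=
  Classical.choose (α.2 i)

theorem mvpFinal_mvpSpot {n : ℕ} (α : MVP n) (i : Fin n) :
    mvpFinal α.1 (mvpSpot α i) = some i :=
  Classical.choose_spec (α.2 i)

theorem mvpSpot_bijective {n : ℕ} (α : MVP n) : Function.Bijective (mvpSpot α) := by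
  refine Finite.injective_iff_bijective.mp (fun i j hij => ?_)
  have h := mvpFinal_mvpSpot α i
  rw [hij, mvpFinal_mvpSpot α j] at h
  exact (Option.some.inj h).symm

/-- The outcome map: `mvpOutcome α k` is the car that is parked in spot `k` at the end. -/
noncomputable def mvpOutcome {n : ℕ} (α : MVP n) : Equiv.Perm (Fin n) :=
  (Equiv.ofBijective (mvpSpot α) (mvpSpot_bijective α)).symm

theorem mvpFinal_eq_mvpOutcome {n : ℕ} (α : MVP n) (k : Fin n) :
    mvpFinal α.1 k = some (mvpOutcome α k) := by
  have h := mvpFinal_mvpSpot α (mvpOutcome α k)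
  rwa [show mvpSpot α (mvpOutcome α k) = k from
    (Equiv.ofBijective (mvpSpot α) (mvpSpot_bijective α)).apply_symm_apply k] at h

/-- The fiber of `π` under the outcome map. -/
def mvpFiber {n : ℕ} (π : Equiv.Perm (Fin n)) : Set (Fin n → Fin n) :=
  {α | ∃ h : α ∈ MVP n, mvpOutcome ⟨α, h⟩ = π}

/-- The cars that arrive after car `π j` and are parked to the left of spot `j` in `π`, together
with car `π j` itself. -/
def laterLeftCars {n : ℕ} (π : Equiv.Perm (Fin n)) (j : Fin n) : Finset (Fin n) :=
  ((Finset.Iio j).image π ∩ Finset.Ioi (π j)) ∪ {π j}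

/-- The set `Ω_j(π)`: the spots on or to the left of spot `j` that are occupied in `π` by a car
of `laterLeftCars π j`. -/
def Omega {n : ℕ} (π : Equiv.Perm (Fin n)) (j : Fin n) : Finset (Fin n) :=
  (Finset.Iic j).filter (fun k => π k ∈ laterLeftCars π j)

/-- `π` contains the pattern `ρ` (a word of distinct numbers): some subsequence of the one-line
notation of `π` is order-isomorphic to `ρ`. -/
def ContainsPattern {n m : ℕ} (π : Equiv.Perm (Fin n)) (ρ : Fin m → ℕ) : Prop :=
  ∃ f : Fin m → Fin n, StrictMono f ∧
    ∀ i j : Fin m, i < j → (π (f i) ≤ π (f j) ↔ ρ i ≤ ρ j)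

/-- `π` avoids the pattern `ρ`. -/
def AvoidsPattern {n m : ℕ} (π : Equiv.Perm (Fin n)) (ρ : Fin m → ℕ) : Prop :=
  ¬ ContainsPattern π ρ

/-! A car only moves right, and an occupied spot changes hands only when a later car prefers it.
Hence, if the outcome is `π`, car `π j` prefers a spot `k ≤ j` whose final owner `π k` is `π j` or a
later car: the fiber always lies in the product of the sets `Omega π j`
(`pref_mem_Omega_of_mem_mvpFiber`), whose size is the product of their sizes.

If `π` avoids both patterns, the inclusion is an equality. By induction on arrivals
(`mvpState_of_avoids`), each arrived car `π j` is either in spot `j` or in a spot to its left whose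
final owner has yet to come and bump it; a failure of this invariant produces one of the patterns.
If `π` contains a pattern, an explicit member of the product, equal to "every car prefers its final
spot" except for two cars, lies outside the fiber, so the inclusion is strict. -/

/-! ### A single arrival -/

theorem mvpStep_of_none {n : ℕ} {c : Street n} {a : Fin n} (i : Fin n) (h : c a = none) :
    mvpStep c i a = Function.update c a (some i) := by
  simp only [mvpStep, h]

theorem mvpStep_of_some {n : ℕ} {c : Street n} {a j : Fin n} (i : Fin n) (h : c a = some j)
    (hf : (freeSpotsAfter c a).Nonempty) :
    mvpStep c i a = Function.update (Function.update c a (some i))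
      ((freeSpotsAfter c a).min' hf) (some j) := by
  simp only [mvpStep, h, dif_pos hf]

theorem mvpStep_of_not_nonempty {n : ℕ} {c : Street n} {a : Fin n} (i : Fin n)
    (hf : ¬(freeSpotsAfter c a).Nonempty) :
    mvpStep c i a = Function.update c a (some i) := by
  cases h : c a with
  | none => exact mvpStep_of_none i h
  | some j => simp only [mvpStep, h, dif_neg hf]

theorem mem_freeSpotsAfter {n : ℕ} {c : Street n} {a k : Fin n} :
    k ∈ freeSpotsAfter c a ↔ a < k ∧ c k = none := by
  simp [freeSpotsAfter]

theorem mvpStep_self {n : ℕ} (c : Street n) (i a : Fin n) : mvpStep c i a a = some i := by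
  cases h : c a with
  | none => rw [mvpStep_of_none i h, Function.update_self]
  | some j =>
    by_cases hf : (freeSpotsAfter c a).Nonempty
    · have hm := mem_freeSpotsAfter.mp (Finset.min'_mem _ hf)
      rw [mvpStep_of_some i h hf, Function.update_of_ne hm.1.ne, Function.update_self]
    · rw [mvpStep_of_not_nonempty i hf, Function.update_self]

theorem mvpStep_of_ne {n : ℕ} {c : Street n} {a p x : Fin n} (i : Fin n) (hp : p ≠ a)
    (hx : c p = some x) : mvpStep c i a p = some x := by
  cases h : c a with
  | none => rw [mvpStep_of_none i h, Function.update_of_ne hp, hx]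
  | some j =>
    by_cases hf : (freeSpotsAfter c a).Nonempty
    · have hm := mem_freeSpotsAfter.mp (Finset.min'_mem _ hf)
      have hpm : p ≠ (freeSpotsAfter c a).min' hf := by
        intro he
        rw [← he, hx] at hm
        exact Option.some_ne_none x hm.2
      rw [mvpStep_of_some i h hf, Function.update_of_ne hpm, Function.update_of_ne hp, hx]
    · rw [mvpStep_of_not_nonempty i hf, Function.update_of_ne hp, hx]

/-- Every car on the street after a step has just arrived, was not moved, or was bumped to the
first unoccupied spot. -/
theorem mvpStep_eq_some {n : ℕ} {c : Street n} {i a p x : Fin n}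
    (h : mvpStep c i a p = some x) :
    (p = a ∧ x = i) ∨ (p ≠ a ∧ c p = some x) ∨
      (c p = none ∧ c a = some x ∧ a < p ∧ ∀ q, a < q → q < p → c q ≠ none) := by
  by_cases hp : p = a
  · subst hp
    rw [mvpStep_self] at h
    exact Or.inl ⟨rfl, (Option.some.inj h).symm⟩
  refine Or.inr ?_
  cases hj : c a with
  | none =>
    rw [mvpStep_of_none i hj, Function.update_of_ne hp] at h
    exact Or.inl ⟨hp, h⟩
  | some j =>
    by_cases hf : (freeSpotsAfter c a).Nonempty
    · rw [mvpStep_of_some i hj hf] at h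
      by_cases hq : p = (freeSpotsAfter c a).min' hf
      · have hm := mem_freeSpotsAfter.mp (Finset.min'_mem _ hf)
        rw [← hq] at hm
        rw [← hq, Function.update_self] at h
        refine Or.inr ⟨hm.2, h, hm.1, fun q haq hqp hcq => ?_⟩
        have := Finset.min'_le _ _ (mem_freeSpotsAfter.mpr ⟨haq, hcq⟩)
        rw [← hq] at this
        exact absurd hqp (not_lt.mpr this)
      · rw [Function.update_of_ne hq, Function.update_of_ne hp] at h
        exact Or.inl ⟨hp, h⟩
    · rw [mvpStep_of_not_nonempty i hf, Function.update_of_ne hp] at h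
      exact Or.inl ⟨hp, h⟩

theorem exists_mvpStep_bumped {n : ℕ} {c : Street n} {a x r : Fin n} (i : Fin n)
    (hx : c a = some x) (har : a < r) (hr : c r = none) :
    ∃ q, a < q ∧ q ≤ r ∧ c q = none ∧ mvpStep c i a q = some x := by
  have hmem := mem_freeSpotsAfter.mpr ⟨har, hr⟩
  have hf : (freeSpotsAfter c a).Nonempty := ⟨r, hmem⟩
  have hm := mem_freeSpotsAfter.mp (Finset.min'_mem _ hf)
  refine ⟨_, hm.1, Finset.min'_le _ _ hmem, hm.2, ?_⟩
  rw [mvpStep_of_some i hx hf, Function.update_self]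

/-! ### Evolution of the street -/

/-- The street after the first `t` cars have arrived. -/
def mvpState {n : ℕ} (α : Fin n → Fin n) (t : ℕ) : Street n :=
  ((List.finRange n).take t).foldl (fun c i => mvpStep c i (α i)) (fun _ => none)

theorem mvpState_zero {n : ℕ} (α : Fin n → Fin n) (p : Fin n) : mvpState α 0 p = none := by
  simp [mvpState]

theorem mvpState_succ {n : ℕ} (α : Fin n → Fin n) (i : Fin n) :
    mvpState α (i + 1) = mvpStep (mvpState α i) i (α i) := by
  have h : (List.finRange n).take (i + 1) = (List.finRange n).take i ++ [i] := by
    rw [List.take_add_one]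
    simp
  simp [mvpState, h]

theorem mvpState_eq_mvpFinal {n : ℕ} (α : Fin n → Fin n) : mvpState α n = mvpFinal α := by
  simp [mvpState, mvpFinal, List.take_of_length_le]

theorem lt_of_mvpState_eq_some {n : ℕ} {α : Fin n → Fin n} {t : ℕ} (ht : t ≤ n) {p x : Fin n}
    (h : mvpState α t p = some x) : (x : ℕ) < t := by
  induction t generalizing p with
  | zero => simp [mvpState_zero] at h
  | succ t ih =>
    rw [mvpState_succ α ⟨t, ht⟩] at h
    rcases mvpStep_eq_some h with ⟨-, rfl⟩ | ⟨-, h⟩ | ⟨-, h, -⟩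
    · simp
    · exact (ih (by omega) h).trans (by omega)
    · exact (ih (by omega) h).trans (by omega)

/-- An occupied spot stays occupied, and its occupant can only be replaced by a later car that
prefers the spot. -/
theorem exists_mvpState_eq_some_of_le {n : ℕ} {α : Fin n → Fin n} {t u : ℕ} (htu : t ≤ u)
    (hu : u ≤ n) {p x : Fin n} (h : mvpState α t p = some x) :
    ∃ y, mvpState α u p = some y ∧ (y = x ∨ t ≤ (y : ℕ) ∧ α y = p) := by
  induction u, htu using Nat.le_induction with
  | base => exact ⟨x, h, Or.inl rfl⟩
  | succ u htu ih =>
    obtain ⟨y, hy, hyx⟩ := ih (by omega)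
    rw [mvpState_succ α ⟨u, hu⟩]
    by_cases hp : p = α ⟨u, hu⟩
    · exact ⟨⟨u, hu⟩, hp ▸ mvpStep_self _ _ _, Or.inr ⟨htu, hp.symm⟩⟩
    · exact ⟨y, mvpStep_of_ne _ hp hy, hyx⟩

theorem eq_or_of_mvpState {n : ℕ} {α : Fin n → Fin n} {t u : ℕ} (htu : t ≤ u)
    (hu : u ≤ n) {p x y : Fin n} (hx : mvpState α t p = some x) (hy : mvpState α u p = some y) :
    y = x ∨ t ≤ (y : ℕ) ∧ α y = p := by
  obtain ⟨z, hz, h⟩ := exists_mvpState_eq_some_of_le htu hu hx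
  rw [hy] at hz
  cases hz
  exact h

theorem mvpState_succ_pref {n : ℕ} (α : Fin n → Fin n) (i : Fin n) :
    mvpState α (i + 1) (α i) = some i := by
  rw [mvpState_succ]
  exact mvpStep_self _ _ _

theorem pref_le_of_mvpState_eq_some {n : ℕ} {α : Fin n → Fin n} {t : ℕ} (ht : t ≤ n)
    {p x : Fin n} (h : mvpState α t p = some x) : α x ≤ p := by
  induction t generalizing p with
  | zero => simp [mvpState_zero] at h
  | succ t ih =>
    rw [mvpState_succ α ⟨t, ht⟩] at h
    rcases mvpStep_eq_some h with ⟨rfl, rfl⟩ | ⟨-, h⟩ | ⟨-, h, hlt, -⟩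
    · exact le_rfl
    · exact ih (by omega) h
    · exact (ih (by omega) h).trans hlt.le

/-- A car that is on the street at some time has been there since its arrival. -/
theorem exists_mvpState_eq_some_of_lt {n : ℕ} {α : Fin n → Fin n} {t u : ℕ} (htu : t ≤ u)
    (hu : u ≤ n) {p x : Fin n} (h : mvpState α u p = some x) (hx : (x : ℕ) < t) :
    ∃ q, mvpState α t q = some x := by
  induction u, htu using Nat.le_induction generalizing p with
  | base => exact ⟨p, h⟩
  | succ u htu ih =>
    rw [mvpState_succ α ⟨u, hu⟩] at h
    rcases mvpStep_eq_some h with ⟨rfl, rfl⟩ | ⟨-, h⟩ | ⟨-, h, -⟩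
    · simp only at hx
      omega
    · exact ih (by omega) h
    · exact ih (by omega) h

theorem mvpState_injective {n : ℕ} {α : Fin n → Fin n} {t : ℕ} (ht : t ≤ n) {p q x : Fin n}
    (hp : mvpState α t p = some x) (hq : mvpState α t q = some x) : p = q := by
  induction t generalizing p q with
  | zero => simp [mvpState_zero] at hp
  | succ t ih =>
    have hlt : ∀ {r}, mvpState α t r = some x → x ≠ ⟨t, ht⟩ := by
      rintro r hr rfl
      exact absurd (lt_of_mvpState_eq_some (by omega) hr) (by simp)
    rw [mvpState_succ α ⟨t, ht⟩] at hp hq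
    rcases mvpStep_eq_some hp with ⟨hpa, hx⟩ | ⟨hpa, hp⟩ | ⟨hp0, hp, hpa, hpm⟩ <;>
    rcases mvpStep_eq_some hq with ⟨hqa, hx'⟩ | ⟨hqa, hq⟩ | ⟨hq0, hq, hqa, hqm⟩
    · rw [hpa, hqa]
    · exact absurd hx (hlt hq)
    · exact absurd hx (hlt hq)
    · exact absurd hx' (hlt hp)
    · exact ih (by omega) hp hq
    · exact absurd (ih (by omega) hp hq) hpa
    · exact absurd hx' (hlt hp)
    · exact absurd (ih (by omega) hq hp) hqa
    · exact le_antisymm (not_lt.mp fun h => hpm q hqa h hq0)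
        (not_lt.mp fun h => hqm p hpa h hp0)

/-- A car does not drive past an unoccupied spot. -/
theorem lt_of_mvpState_eq_none {n : ℕ} {α : Fin n → Fin n} {t : ℕ} (ht : t ≤ n) {p r x : Fin n}
    (hr : mvpState α t r = none) (hp : mvpState α t p = some x) (hx : α x < r) : p < r := by
  induction t generalizing p with
  | zero => simp [mvpState_zero] at hp
  | succ t ih =>
    have hr' : mvpState α t r = none := by
      by_contra hne
      obtain ⟨y, hy⟩ := Option.ne_none_iff_exists'.mp hne
      obtain ⟨z, hz, -⟩ := exists_mvpState_eq_some_of_le (Nat.le_succ t) ht hy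
      rw [hr] at hz
      cases hz
    have hpr : p ≠ r := by
      rintro rfl
      rw [hr] at hp
      cases hp
    rw [mvpState_succ α ⟨t, ht⟩] at hp
    rcases mvpStep_eq_some hp with ⟨rfl, rfl⟩ | ⟨-, hp⟩ | ⟨-, hp, hpa, hpm⟩
    · exact hx
    · exact ih (by omega) hr' hp
    · exact lt_of_le_of_ne (not_lt.mp fun h => hpm r (ih (by omega) hr' hp) h hr') hpr

/-! ### Fibers, preference sets and patterns -/

theorem mem_mvpFiber_iff {n : ℕ} {π : Equiv.Perm (Fin n)} {α : Fin n → Fin n} :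
    α ∈ mvpFiber π ↔ ∀ k, mvpFinal α k = some (π k) := by
  constructor
  · rintro ⟨h, rfl⟩ k
    exact mvpFinal_eq_mvpOutcome ⟨α, h⟩ k
  · intro h
    have hα : α ∈ MVP n := fun i => ⟨π.symm i, by rw [h, Equiv.apply_symm_apply]⟩
    refine ⟨hα, Equiv.ext fun k => ?_⟩
    have hk := mvpFinal_eq_mvpOutcome ⟨α, hα⟩ k
    rw [h k] at hk
    exact (Option.some.inj hk).symm

theorem mem_Omega_iff {n : ℕ} {π : Equiv.Perm (Fin n)} {j k : Fin n} :
    k ∈ Omega π j ↔ k ≤ j ∧ π j ≤ π k := by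
  simp only [Omega, laterLeftCars, Finset.mem_filter, Finset.mem_Iic, Finset.mem_union,
    Finset.mem_inter, Finset.mem_image, Finset.mem_Iio, Finset.mem_Ioi, Finset.mem_singleton,
    EmbeddingLike.apply_eq_iff_eq, exists_eq_right]
  constructor
  · rintro ⟨h, ⟨-, h'⟩ | rfl⟩
    · exact ⟨h, h'.le⟩
    · exact ⟨h, le_rfl⟩
  · rintro ⟨h, h'⟩
    refine ⟨h, ?_⟩
    rcases eq_or_lt_of_le h with rfl | hlt
    · exact Or.inr rfl
    · exact Or.inl ⟨hlt, lt_of_le_of_ne h' fun he => hlt.ne' (π.injective he)⟩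

/-- Cars only move right, and right after its arrival `π j` occupies the spot it prefers, so that
spot ends with `π j` or a later car. -/
theorem pref_mem_Omega_of_mem_mvpFiber {n : ℕ} {π : Equiv.Perm (Fin n)} {α : Fin n → Fin n}
    (h : α ∈ mvpFiber π) (j : Fin n) : α (π j) ∈ Omega π j := by
  rw [mem_mvpFiber_iff, ← mvpState_eq_mvpFinal] at h
  refine mem_Omega_iff.mpr ⟨pref_le_of_mvpState_eq_some le_rfl (h j), ?_⟩
  rcases eq_or_of_mvpState (π j).isLt le_rfl (mvpState_succ_pref α (π j)) (h (α (π j)))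
    with h | ⟨h, -⟩
  · exact h.ge
  · exact Fin.le_def.mpr (by omega)

theorem containsPattern_321_iff {n : ℕ} {π : Equiv.Perm (Fin n)} :
    ContainsPattern π ![3, 2, 1] ↔ ∃ i j k, i < j ∧ j < k ∧ π k < π j ∧ π j < π i := by
  constructor
  · rintro ⟨f, hf, h⟩
    refine ⟨f 0, f 1, f 2, hf (by decide), hf (by decide), ?_, ?_⟩
    · simpa using h 1 2 (by decide)
    · simpa using h 0 1 (by decide)
  · rintro ⟨i, j, k, hij, hjk, h1, h2⟩
    refine ⟨![i, j, k], ?_, ?_⟩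
    · refine Fin.strictMono_iff_lt_succ.mpr fun a => ?_
      fin_cases a <;> simpa
    · intro a b hab
      fin_cases a <;> fin_cases b <;> simp_all [h1.trans h2]

theorem containsPattern_3412_iff {n : ℕ} {π : Equiv.Perm (Fin n)} :
    ContainsPattern π ![3, 4, 1, 2] ↔ ∃ i j k l, i < j ∧ j < k ∧ k < l ∧
      π k < π l ∧ π l < π i ∧ π i < π j := by
  constructor
  · rintro ⟨f, hf, h⟩
    have h01 : f 0 < f 1 := hf (by decide)
    have h23 : f 2 < f 3 := hf (by decide)
    refine ⟨f 0, f 1, f 2, f 3, h01, hf (by decide), h23, ?_, ?_, ?_⟩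
    · exact lt_of_le_of_ne (by simpa using h 2 3 (by decide)) (π.injective.ne h23.ne)
    · simpa using h 0 3 (by decide)
    · exact lt_of_le_of_ne (by simpa using h 0 1 (by decide)) (π.injective.ne h01.ne)
  · rintro ⟨i, j, k, l, hij, hjk, hkl, h1, h2, h3⟩
    refine ⟨![i, j, k, l], ?_, ?_⟩
    · refine Fin.strictMono_iff_lt_succ.mpr fun a => ?_
      fin_cases a <;> simpa
    · intro a b hab
      fin_cases a <;> fin_cases b <;>
        simp_all [h1.le, h3.le, h1.trans h2, h2.trans h3, (h1.trans h2).trans h3]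

/-! ### Avoiding permutations -/

/-- In an avoiding permutation, a bumped car finds a spot from which it can still reach its final
spot: this is preserved by every arrival. -/
theorem mvpState_of_avoids {n : ℕ} {π : Equiv.Perm (Fin n)}
    (h321 : AvoidsPattern π ![3, 2, 1]) (h3412 : AvoidsPattern π ![3, 4, 1, 2])
    {α : Fin n → Fin n} (hα : ∀ j, α (π j) ∈ Omega π j) {t : ℕ} (ht : t ≤ n) (j : Fin n)
    (hj : (π j : ℕ) < t) :
    ∃ p, mvpState α t p = some (π j) ∧ p ≤ j ∧ (p = j ∨ t ≤ (π p : ℕ)) := by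
  rw [AvoidsPattern, containsPattern_321_iff] at h321
  rw [AvoidsPattern, containsPattern_3412_iff] at h3412
  induction t generalizing j with
  | zero => omega
  | succ t ih =>
    replace ih := fun j => ih (by omega) (j := j)
    obtain ⟨s, hs⟩ := π.surjective ⟨t, ht⟩
    have hst : (π s : ℕ) = t := by rw [hs]
    obtain ⟨hks, hsk⟩ := mem_Omega_iff.mp (hα s)
    have hstep : mvpState α (t + 1) = mvpStep (mvpState α t) (π s) (α (π s)) := by
      rw [hs]
      exact mvpState_succ α ⟨t, ht⟩
    rw [hstep]
    generalize α (π s) = k at hks hsk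
    by_cases hjs : j = s
    · subst hjs
      refine ⟨k, mvpStep_self _ _ _, hks, ?_⟩
      by_cases hkj : k = j
      · exact Or.inl hkj
      · have := lt_of_le_of_ne hsk (π.injective.ne (Ne.symm hkj))
        exact Or.inr (by rw [Fin.lt_def] at this; omega)
    have hjs' : (π j : ℕ) ≠ t := fun h => hjs (π.injective (Fin.ext (h.trans hst.symm)))
    have hjt : (π j : ℕ) < t := by omega
    obtain ⟨p, hp, hpj, hp'⟩ := ih j hjt
    by_cases hpk : p = k
    · subst hpk
      have hjp : π j < π p := lt_of_lt_of_le (Fin.lt_def.mpr (by omega)) hsk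
      have hpj' : p < j := lt_of_le_of_ne hpj fun h => hjp.ne (by rw [h])
      -- By the invariant, an occupant of `j` would be `π j` itself, which sits at `p`, or a car
      -- waiting for `π j`, which has already arrived.
      have hfree : mvpState α t j = none := by
        by_contra hne
        obtain ⟨x, hx⟩ := Option.ne_none_iff_exists'.mp hne
        obtain ⟨m, rfl⟩ := π.surjective x
        obtain ⟨r, hr, hrm, hr'⟩ := ih m (lt_of_mvpState_eq_some (by omega) hx)
        have hrj : r = j := mvpState_injective (by omega) hr hx
        subst hrj
        rcases hr' with rfl | hr'
        · exact hpj'.ne (mvpState_injective (by omega) hp hx)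
        · omega
      obtain ⟨q, hpq, hqj, hq, hqx⟩ := exists_mvpStep_bumped (π s) hp hpj' hfree
      refine ⟨q, hqx, hqj, ?_⟩
      -- Suppose `π j` stops at some `q < j` whose owner `π q` has arrived. Either `π q` is the new
      -- car, or it sits at some `r < q` whose owner has not arrived before time `t`; both cases
      -- give a pattern.
      by_contra hcon
      push Not at hcon
      obtain ⟨hqj', hqt⟩ := hcon
      have hqj : q < j := lt_of_le_of_ne hqj hqj'
      by_cases hqs : q = s
      · subst hqs
        exact h321 ⟨p, q, j, hpq, hqj, Fin.lt_def.mpr (by omega),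
          lt_of_le_of_ne hsk (π.injective.ne hpq.ne')⟩
      have hqs' : (π q : ℕ) ≠ t := fun h => hqs (π.injective (Fin.ext (h.trans hst.symm)))
      obtain ⟨r, hr, hrq, hr'⟩ := ih q (by omega)
      have hrq' : r ≠ q := by
        rintro rfl
        rw [hq] at hr
        cases hr
      have hrt : t ≤ (π r : ℕ) := hr'.resolve_left hrq'
      have hrq : r < q := lt_of_le_of_ne hrq hrq'
      have hrp : r ≠ p := by
        rintro rfl
        rw [hp] at hr
        exact hqj' (π.injective (Option.some.inj hr)).symm
      have hjr : π j < π r := Fin.lt_def.mpr (by omega)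
      rcases lt_or_gt_of_ne (π.injective.ne hqj') with hlt | hlt
      · rcases lt_or_gt_of_ne hrp with hrp | hrp <;>
        rcases lt_or_gt_of_ne (π.injective.ne hrp.ne) with hπ | hπ
        · exact h3412 ⟨r, p, q, j, hrp, hpq, hqj, hlt, hjr, hπ⟩
        · exact h321 ⟨r, p, j, hrp, hpj', hjp, hπ⟩
        · exact h3412 ⟨p, r, q, j, hrp, hrq, hqj, hlt, hjp, hπ⟩
        · exact h321 ⟨p, r, j, hrp, hrq.trans hqj, hjr, hπ⟩
      · exact h321 ⟨r, q, j, hrq, hqj, hlt, Fin.lt_def.mpr (by omega)⟩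
    · refine ⟨p, mvpStep_of_ne _ hpk hp, hpj, ?_⟩
      rcases hp' with h | h
      · exact Or.inl h
      -- If the awaited owner of `p` arrives now but prefers `k < p`, then `k, p, j` form 321.
      · by_cases hps : p = s
        · subst hps
          have hkp : k < p := lt_of_le_of_ne hks (Ne.symm hpk)
          have hpj' : p ≠ j := fun h => hjs h.symm
          exact absurd ⟨k, p, j, hkp, lt_of_le_of_ne hpj hpj', Fin.lt_def.mpr (by omega),
            lt_of_le_of_ne hsk (π.injective.ne hkp.ne')⟩ h321
        · have : (π p : ℕ) ≠ t := fun h => hps (π.injective (Fin.ext (h.trans hst.symm)))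
          exact Or.inr (by omega)

theorem mem_mvpFiber_of_avoids {n : ℕ} {π : Equiv.Perm (Fin n)}
    (h321 : AvoidsPattern π ![3, 2, 1]) (h3412 : AvoidsPattern π ![3, 4, 1, 2])
    {α : Fin n → Fin n} (hα : ∀ j, α (π j) ∈ Omega π j) : α ∈ mvpFiber π := by
  rw [mem_mvpFiber_iff, ← mvpState_eq_mvpFinal]
  intro k
  -- At time `n` no owner is still to come, so every car is in its final spot.
  obtain ⟨p, hp, -, rfl | h⟩ := mvpState_of_avoids h321 h3412 hα le_rfl k (π k).isLt
  · exact hp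
  · exact absurd h (not_le.mpr (π p).isLt)

/-! ### Permutations containing a pattern -/

theorem exists_not_mem_mvpFiber_of_contains_321 {n : ℕ} {π : Equiv.Perm (Fin n)}
    (h : ContainsPattern π ![3, 2, 1]) :
    ∃ α : Fin n → Fin n, (∀ j, α (π j) ∈ Omega π j) ∧ α ∉ mvpFiber π := by
  obtain ⟨u, v, w, huv, hvw, hwv, hvu⟩ := containsPattern_321_iff.mp h
  -- `β j` is the preference of car `π j`. Car `π w` takes spot `v` before `π v` arrives, so `π v`
  -- could own `v` only by preferring it; it prefers `u`.
  let β : Fin n → Fin n := Function.update (Function.update id v u) w v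
  have hβv : β v = u := by simp [β, hvw.ne]
  have hβw : β w = v := by simp [β]
  refine ⟨β ∘ π.symm, fun j => ?_, fun hα => ?_⟩
  · rw [mem_Omega_iff, Function.comp_apply, Equiv.symm_apply_apply]
    by_cases hjw : j = w
    · subst hjw
      rw [hβw]
      exact ⟨hvw.le, hwv.le⟩
    by_cases hjv : j = v
    · subst hjv
      rw [hβv]
      exact ⟨huv.le, hvu.le⟩
    simp [β, hjw, hjv]
  · rw [mem_mvpFiber_iff, ← mvpState_eq_mvpFinal] at hα
    have h1 := mvpState_succ_pref (β ∘ π.symm) (π w)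
    rw [Function.comp_apply, Equiv.symm_apply_apply, hβw] at h1
    obtain ⟨y, hy, -⟩ := exists_mvpState_eq_some_of_le (Fin.lt_def.mp hwv) (π v).isLt.le h1
    have hylt := lt_of_mvpState_eq_some (π v).isLt.le hy
    rcases eq_or_of_mvpState (π v).isLt.le le_rfl hy (hα v) with h | ⟨-, h⟩
    · rw [h] at hylt
      exact lt_irrefl _ hylt
    · rw [Function.comp_apply, Equiv.symm_apply_apply, hβv] at h
      exact huv.ne h

/-- Let `π w` prefer `v` and `π z` prefer `u`. Just before `π v` arrives, `π w` sits at `v` and `w`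
is free, so `π z`, bumped from `u` by `π u`, is stuck strictly between `u` and `w`, in a spot whose
owner can no longer displace it. -/
theorem exists_not_mem_mvpFiber_of_contains_3412 {n : ℕ} {π : Equiv.Perm (Fin n)}
    (h : ContainsPattern π ![3, 4, 1, 2]) :
    ∃ α : Fin n → Fin n, (∀ j, α (π j) ∈ Omega π j) ∧ α ∉ mvpFiber π := by
  obtain ⟨u, v', w, z, huv', hvw', hwz, hwz', hzu', huv''⟩ := containsPattern_3412_iff.mp h
  -- Replacing the "4" by the latest car between `u` and `w` ensures that from the arrival of `π v`
  -- on, no other owner of a spot in this interval is still to come.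
  obtain ⟨v, hv, hmax⟩ := Finset.exists_max_image (Finset.Ioo u w) π
    ⟨v', Finset.mem_Ioo.mpr ⟨huv', hvw'⟩⟩
  obtain ⟨huv, hvw⟩ := Finset.mem_Ioo.mp hv
  have huv' : π u < π v := huv''.trans_le (hmax v' (Finset.mem_Ioo.mpr ⟨‹_›, hvw'⟩))
  have hzv' := hzu'.trans huv'
  let β : Fin n → Fin n := Function.update (Function.update id w v) z u
  have hβw : β w = v := by simp [β, hwz.ne]
  have hβz : β z = u := by simp [β]
  have hβ : ∀ j, j ≠ w → j ≠ z → β j = j := fun j h1 h2 => by simp [β, h1, h2]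
  have hβπ : ∀ j, (β ∘ π.symm) (π j) = β j := fun j => by simp
  refine ⟨β ∘ π.symm, fun j => ?_, fun hα => ?_⟩
  · rw [mem_Omega_iff, hβπ]
    by_cases hjw : j = w
    · subst hjw
      rw [hβw]
      exact ⟨hvw.le, (hwz'.trans hzv').le⟩
    by_cases hjz : j = z
    · subst hjz
      rw [hβz]
      exact ⟨((huv.trans hvw).trans hwz).le, hzu'.le⟩
    rw [hβ j hjw hjz]
    exact ⟨le_rfl, le_rfl⟩
  · rw [mem_mvpFiber_iff, ← mvpState_eq_mvpFinal] at hα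
    set α := β ∘ π.symm
    have hd : (π v : ℕ) ≤ n := (π v).isLt.le
    have hwv : mvpState α (π v) v = some (π w) := by
      have h1 := mvpState_succ_pref α (π w)
      rw [hβπ, hβw] at h1
      obtain ⟨y, hy, hyw⟩ :=
        exists_mvpState_eq_some_of_le (Fin.lt_def.mp (hwz'.trans hzv')) hd h1
      rcases hyw with rfl | ⟨hyw, hyv⟩
      · exact hy
      exfalso
      obtain ⟨m, rfl⟩ := π.surjective y
      have hlt := lt_of_mvpState_eq_some hd hy
      rw [hβπ] at hyv
      by_cases hmw : m = w
      · subst hmw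
        omega
      by_cases hmz : m = z
      · subst hmz
        rw [hβz] at hyv
        exact huv.ne hyv
      rw [hβ m hmw hmz] at hyv
      subst hyv
      exact lt_irrefl _ hlt
    -- An occupant of `w` now would have to be its final owner `π w`, which is at `v`, or be
    -- replaced later by `π w`, which has already arrived.
    have hfree : mvpState α (π v) w = none := by
      by_contra hne
      obtain ⟨y, hy⟩ := Option.ne_none_iff_exists'.mp hne
      rcases eq_or_of_mvpState hd le_rfl hy (hα w) with rfl | ⟨hle, -⟩
      · exact hvw.ne (mvpState_injective hd hwv hy)
      · exact absurd (hwz'.trans hzv') (not_lt.mpr (Fin.le_def.mpr hle))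
    obtain ⟨m, hm⟩ := exists_mvpState_eq_some_of_lt hd le_rfl (hα z) (Fin.lt_def.mp hzv')
    have hum : u ≤ m := by
      have := pref_le_of_mvpState_eq_some hd hm
      rwa [hβπ, hβz] at this
    have hmw : m < w := lt_of_mvpState_eq_none hd hfree hm (by
      rw [hβπ, hβz]
      exact huv.trans hvw)
    have hmu : u ≠ m := by
      rintro rfl
      have h1 := mvpState_succ_pref α (π u)
      rw [hβπ, hβ u (huv.trans hvw).ne ((huv.trans hvw).trans hwz).ne] at h1
      rcases eq_or_of_mvpState (Fin.lt_def.mp huv') hd h1 hm with h | ⟨h, -⟩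
      · exact hzu'.ne h
      · rw [Fin.lt_def] at hzu'
        omega
    have hle : π m ≤ π v := hmax m (Finset.mem_Ioo.mpr ⟨lt_of_le_of_ne hum hmu, hmw⟩)
    rcases eq_or_of_mvpState hd le_rfl hm (hα m) with h | ⟨h, -⟩
    · exact (hmw.trans hwz).ne (π.injective h)
    · have hmv : m = v := π.injective (le_antisymm hle (Fin.le_def.mpr h))
      rw [hmv, hwv] at hm
      exact hwz'.ne (Option.some.inj hm)

/-! ### Counting -/

theorem ncard_setOf_pref_mem_Omega {n : ℕ} (π : Equiv.Perm (Fin n)) :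
    {α : Fin n → Fin n | ∀ j, α (π j) ∈ Omega π j}.ncard = ∏ j, (Omega π j).card := by
  have h : {α : Fin n → Fin n | ∀ j, α (π j) ∈ Omega π j} =
      (fun β : Fin n → Fin n => β ∘ π.symm) '' (Fintype.piFinset (Omega π) : Set _) := by
    ext α
    simp only [Set.mem_ofPred_eq, Set.mem_image, Finset.mem_coe, Fintype.mem_piFinset]
    constructor
    · exact fun h => ⟨α ∘ π, h, by ext; simp⟩
    · rintro ⟨β, hβ, rfl⟩ j
      simpa using hβ j
  rw [h, Set.ncard_image_of_injective _ π.symm.surjective.injective_comp_right,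
    Set.ncard_coe_finset, Fintype.card_piFinset]

theorem ncard_mvpFiber_lt {n : ℕ} {π : Equiv.Perm (Fin n)}
    (h : ContainsPattern π ![3, 2, 1] ∨ ContainsPattern π ![3, 4, 1, 2]) :
    (mvpFiber π).ncard < ∏ j : Fin n, (Omega π j).card := by
  obtain ⟨α, hα, hα'⟩ := h.elim exists_not_mem_mvpFiber_of_contains_321
    exists_not_mem_mvpFiber_of_contains_3412
  rw [← ncard_setOf_pref_mem_Omega]
  exact Set.ncard_lt_ncard (Set.ssubset_iff_exists.mpr
    ⟨fun _ h => pref_mem_Omega_of_mem_mvpFiber h, α, hα, hα'⟩) (Set.toFinite _)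

theorem theorem3 (n : ℕ) (π : Equiv.Perm (Fin n)) :
    ((mvpFiber π).ncard = ∏ j : Fin n, (Omega π j).card ↔
      AvoidsPattern π ![3, 2, 1] ∧ AvoidsPattern π ![3, 4, 1, 2]) ∧
    (ContainsPattern π ![3, 2, 1] ∨ ContainsPattern π ![3, 4, 1, 2] →
      (mvpFiber π).ncard < ∏ j : Fin n, (Omega π j).card) ∧
    (AvoidsPattern π ![3, 2, 1] ∧ AvoidsPattern π ![3, 4, 1, 2] →
      ∀ α : Fin n → Fin n, (∀ j : Fin n, α (π j) ∈ Omega π j) → α ∈ mvpFiber π) := by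
  refine ⟨⟨fun h => ?_, fun h => ?_⟩, ncard_mvpFiber_lt,
    fun h α hα => mem_mvpFiber_of_avoids h.1 h.2 hα⟩
  · exact ⟨fun hc => (ncard_mvpFiber_lt (Or.inl hc)).ne h,
      fun hc => (ncard_mvpFiber_lt (Or.inr hc)).ne h⟩
  · rw [← ncard_setOf_pref_mem_Omega]
    congr 1
    exact Set.Subset.antisymm (fun _ h => pref_mem_Omega_of_mem_mvpFiber h)
      fun _ hα => mem_mvpFiber_of_avoids h.1 h.2 hα
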